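/- Extriangulated categories $(\mathcal C,\mathbb E,\mathfrak s)$ are understood in the sense of Nakaoka and Palu; an $\mathbb E$-triangle $X\xrightarrow{x}Y\xrightarrow{y}Z\overset{\delta}{\dashrightarrow}$ is a sequence realizing $\delta\in\mathbb E(Z,X)$, the pair $(x,y)$ is then called a conflation, $x$ an inflation and $y$ a deflation. **Exactness.** A morphism is *compatible* if it is an isomorphism whenever it is both an inflation and a deflation. A sequence $X\xrightarrow{f}Y\xrightarrow{g}Z$ is *right exact* if $f=h_2h_1$ for a compatible deflation $h_1:X\to K$ and a conflation $K\xrightarrow{h_2}Y\xrightarrow{g}Z$; *left exact* if $g=h_2h_1$ for a conflation $X\xrightarrow{f}Y\xrightarrow{h_1}K$ and a compatible inflation $h_2:K\to Z$. A four-term sequence $X\xrightarrow{f}Y\xrightarrow{g}Z\xrightarrow{h}W$ is a *right (resp. left) exact $\mathbb E$-triangle sequence* if $g=g_2g_1$ for conflations $X\xrightarrow{f}Y\xrightarrow{g_1}K$ and $K\xrightarrow{g_2}Z\xrightarrow{h}W$ with $g_1$ (resp. $g_2$) compatible. An additive functor $F$ is *exact* if for every $\mathbb E$-triangle $X\xrightarrow{x}Y\xrightarrow{y}Z\dashrightarrow$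 the sequence $FX\xrightarrow{Fx}FY\xrightarrow{Fy}FZ$ is again part of an $\mathbb E$-triangle; it is *right (resp. left) exact* if it preserves compatible morphisms and right (resp. left) exact sequences. **Recollements.** A recollement $R(\mathcal A',\mathcal A,\mathcal A'')$ of extriangulated categories consists of two exact functors $i_*:\mathcal A'\to\mathcal A$, $j^*:\mathcal A\to\mathcal A''$, two right exact functors $i^*:\mathcal A\to\mathcal A'$, $j_!:\mathcal A''\to\mathcal A$ and two left exact functors $i^!:\mathcal A\to\mathcal A'$, $j_*:\mathcal A''\to\mathcal A$ such that - (R1) $(i^*,i_*,i^!)$ and $(j_!,j^*,j_*)$ are adjoint triples; - (R2) $i_*$, $j_!$, $j_*$ are fully faithful; - (R3) the essential image of $i_*$ is the kernel of $j^*$; - (R4) for each $X\in\mathcal A$ there is a left exact $\mathbb E$-triangle sequence $i_*i^!X\to X\to j_*j^*X\to i_*Y$ with $Y\in\mathcal A'$; - (R5) for each $X\in\mathcal A$ there is a right exact $\mathbb E$-triangle sequence $i_*Y'\to j_!j^*X\to X\to i_*i^*X$ with $Y'\in\mathcal A'$, where the morphisms to and from $X$ in (R4) and (R5) are the adjunction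 morphisms. **Gorenstein projectives.** An object $P$ of $\mathcal C$ is *projective* if $0\to\mathcal C(P,X)\to\mathcal C(P,Y)\to\mathcal C(P,Z)\to0$ is exact for every $\mathbb E$-triangle $X\to Y\to Z\dashrightarrow$; let $\mathcal P(\mathcal C)$ be the class of these. For a class $\mathcal W$ of objects, an $\mathbb E$-triangle $X\to Y\to Z\dashrightarrow$ is $\mathcal C(-,\mathcal W)$-*exact* (resp. $\mathcal C(\mathcal W,-)$-*exact*) if for every $W\in\mathcal W$ the sequence $0\to\mathcal C(Z,W)\to\mathcal C(Y,W)\to\mathcal C(X,W)\to0$ (resp. $0\to\mathcal C(W,X)\to\mathcal C(W,Y)\to\mathcal C(W,Z)\to0$) is exact. An unbounded complex $\cdots\to X_1\xrightarrow{d_1}X_0\xrightarrow{d_0}X_{-1}\to\cdots$ is *exact* if there are $\mathbb E$-triangles $K_{n+1}\xrightarrow{g_n}X_n\xrightarrow{f_n}K_n\dashrightarrow$ with $d_n=g_{n-1}f_n$ for all $n\in\mathbb Z$; it is $\mathcal C(-,\mathcal W)$-*exact* (resp. $\mathcal C(\mathcal W,-)$-*exact*) if these $\mathbb E$-triangles can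 be chosen to be so. A *complete projective resolution* is a complex of projective objects that is exact, $\mathcal C(-,\mathcal P(\mathcal C))$-exact and $\mathcal C(\mathcal P(\mathcal C),-)$-exact. An object is *Gorenstein projective* if it is one of the $K_n$ in a family of $\mathcal C(-,\mathcal P(\mathcal C))$-exact $\mathbb E$-triangles as above for some complete projective resolution. Write $\mathcal{GP}(\mathcal C)$ for the class of these objects. **Proposition.** Let $R(\mathcal A',\mathcal A,\mathcal A'')$ be a recollement of extriangulated categories, $X'\in\mathcal{GP}(\mathcal A')$ and $X''\in\mathcal{GP}(\mathcal A'')$. 1. If $i^!$ and $i^*$ are exact and $i^*$ is faithful, then $i_*X'\in\mathcal{GP}(\mathcal A)$. 2. If $j_!$ and $j_*$ are exact, then $j_!X''\in\mathcal{GP}(\mathcal A)$. -/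

import Mathlib

open CategoryTheory CategoryTheory.Limits Opposite

universe w w₁ w₂ w₃ v v₁ v₂ v₃ u u₁ u₂ u₃

/-- The data `(𝔼, 𝔰)` making an additive category `C` into an extriangulated category
`(C, 𝔼, 𝔰)` in the sense of Nakaoka and Palu.

`𝔼` is an additive bifunctor `Cᵒᵖ × C ⥤ Ab`. The realization `𝔰`, which attaches to each
`δ ∈ 𝔼(Z, X)` an equivalence class of sequences `X ⟶ Y ⟶ Z`, is given by the predicate
`Realizes x y δ`, meaning `𝔰(δ) = [X --x--> Y --y--> Z]`; the three fields `exists_realizes`,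
`realizes_of_iso` and `iso_of_realizes` say that the sequences realizing `δ` form exactly one
equivalence class. For `δ ∈ 𝔼(Z, X)`, the element `a_* δ` is `(E.obj (op Z)).map a δ` and `c^* δ`
is `(E.map c.op).app X δ`. -/
structure ExtriangulatedStructure (C : Type u) [Category.{v} C] [Preadditive C]
    [HasZeroObject C] [HasBinaryBiproducts C] where
  /-- The additive bifunctor `𝔼`. -/
  E : Cᵒᵖ ⥤ C ⥤ AddCommGrpCat.{w}
  additive_left : ∀ (X : C) {Z Z' : C} (c c' : Z' ⟶ Z) (δ : (E.obj (op Z)).obj X),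
    (E.map (c + c').op).app X δ = (E.map c.op).app X δ + (E.map c'.op).app X δ
  additive_right : ∀ (Z : C) {X X' : C} (a a' : X ⟶ X') (δ : (E.obj (op Z)).obj X),
    (E.obj (op Z)).map (a + a') δ = (E.obj (op Z)).map a δ + (E.obj (op Z)).map a' δ
  /-- `Realizes x y δ` means that the sequence `x, y` belongs to the class `𝔰(δ)`. -/
  Realizes : ∀ {X Y Z : C}, (X ⟶ Y) → (Y ⟶ Z) → (E.obj (op Z)).obj X → Prop
  exists_realizes : ∀ {X Z : C} (δ : (E.obj (op Z)).obj X),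
    ∃ (Y : C) (x : X ⟶ Y) (y : Y ⟶ Z), Realizes x y δ
  realizes_of_iso : ∀ {X Y Y' Z : C} {x : X ⟶ Y} {y : Y ⟶ Z} {x' : X ⟶ Y'} {y' : Y' ⟶ Z}
    {δ : (E.obj (op Z)).obj X} (b : Y ≅ Y'), x ≫ b.hom = x' → b.hom ≫ y' = y →
    Realizes x y δ → Realizes x' y' δ
  iso_of_realizes : ∀ {X Y Y' Z : C} {x : X ⟶ Y} {y : Y ⟶ Z} {x' : X ⟶ Y'} {y' : Y' ⟶ Z}
    {δ : (E.obj (op Z)).obj X}, Realizes x y δ → Realizes x' y' δ →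
    ∃ b : Y ≅ Y', x ≫ b.hom = x' ∧ b.hom ≫ y' = y
  /-- Morphisms of extensions are realized by morphisms of sequences. -/
  exists_middle : ∀ {X Y Z X' Y' Z' : C} {x : X ⟶ Y} {y : Y ⟶ Z} {x' : X' ⟶ Y'} {y' : Y' ⟶ Z'}
    {δ : (E.obj (op Z)).obj X} {δ' : (E.obj (op Z')).obj X'},
    Realizes x y δ → Realizes x' y' δ' → ∀ (a : X ⟶ X') (c : Z ⟶ Z'),
    (E.obj (op Z)).map a δ = (E.map c.op).app X' δ' →
    ∃ b : Y ⟶ Y', x ≫ b = a ≫ x' ∧ b ≫ y' = y ≫ c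
  /-- Additivity of `𝔰`: the zero extension is realized by the split sequence. -/
  realizes_zero : ∀ X Z : C,
    Realizes (biprod.inl : X ⟶ X ⊞ Z) (biprod.snd : X ⊞ Z ⟶ Z) (0 : (E.obj (op Z)).obj X)
  /-- Additivity of `𝔰`: `𝔰(δ ⊕ δ') = 𝔰(δ) ⊕ 𝔰(δ')`. -/
  realizes_biprod : ∀ {X Y Z X' Y' Z' : C} {x : X ⟶ Y} {y : Y ⟶ Z} {x' : X' ⟶ Y'} {y' : Y' ⟶ Z'}
    {δ : (E.obj (op Z)).obj X} {δ' : (E.obj (op Z')).obj X'},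
    Realizes x y δ → Realizes x' y' δ' →
    Realizes (biprod.map x x') (biprod.map y y')
      ((E.map (biprod.fst : Z ⊞ Z' ⟶ Z).op).app (X ⊞ X')
          ((E.obj (op Z)).map (biprod.inl : X ⟶ X ⊞ X') δ) +
        (E.map (biprod.snd : Z ⊞ Z' ⟶ Z').op).app (X ⊞ X')
          ((E.obj (op Z')).map (biprod.inr : X' ⟶ X ⊞ X') δ'))
  /-- Axiom (ET3). -/
  et3 : ∀ {X Y Z X' Y' Z' : C} {x : X ⟶ Y} {y : Y ⟶ Z} {x' : X' ⟶ Y'} {y' : Y' ⟶ Z'}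
    {δ : (E.obj (op Z)).obj X} {δ' : (E.obj (op Z')).obj X'},
    Realizes x y δ → Realizes x' y' δ' → ∀ (a : X ⟶ X') (b : Y ⟶ Y'), x ≫ b = a ≫ x' →
    ∃ c : Z ⟶ Z', b ≫ y' = y ≫ c ∧ (E.obj (op Z)).map a δ = (E.map c.op).app X' δ'
  /-- Axiom (ET3)ᵒᵖ. -/
  et3_op : ∀ {X Y Z X' Y' Z' : C} {x : X ⟶ Y} {y : Y ⟶ Z} {x' : X' ⟶ Y'} {y' : Y' ⟶ Z'}
    {δ : (E.obj (op Z)).obj X} {δ' : (E.obj (op Z')).obj X'},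
    Realizes x y δ → Realizes x' y' δ' → ∀ (b : Y ⟶ Y') (c : Z ⟶ Z'), b ≫ y' = y ≫ c →
    ∃ a : X ⟶ X', x ≫ b = a ≫ x' ∧ (E.obj (op Z)).map a δ = (E.map c.op).app X' δ'
  /-- Axiom (ET4). -/
  et4 : ∀ {A B D G F : C} {f : A ⟶ B} {f' : B ⟶ D} {g : B ⟶ G} {g' : G ⟶ F}
    {δ : (E.obj (op D)).obj A} {δ' : (E.obj (op F)).obj B},
    Realizes f f' δ → Realizes g g' δ' →
    ∃ (H : C) (h' : G ⟶ H) (d : D ⟶ H) (e : H ⟶ F) (δ'' : (E.obj (op H)).obj A),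
      g ≫ h' = f' ≫ d ∧ h' ≫ e = g' ∧ Realizes (f ≫ g) h' δ'' ∧
      Realizes d e ((E.obj (op F)).map f' δ') ∧
      (E.map d.op).app A δ'' = δ ∧
      (E.obj (op H)).map f δ'' = (E.map e.op).app B δ'
  /-- Axiom (ET4)ᵒᵖ. -/
  et4_op : ∀ {D A B F G : C} {f' : D ⟶ A} {f : A ⟶ B} {g' : F ⟶ B} {g : B ⟶ G}
    {δ : (E.obj (op B)).obj D} {δ' : (E.obj (op G)).obj F},
    Realizes f' f δ → Realizes g' g δ' →
    ∃ (H : C) (h' : H ⟶ A) (d : D ⟶ H) (e : H ⟶ F) (δ'' : (E.obj (op G)).obj H),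
      d ≫ h' = f' ∧ h' ≫ f = e ≫ g' ∧ Realizes h' (f ≫ g) δ'' ∧
      Realizes d e ((E.map g'.op).app D δ) ∧
      (E.obj (op G)).map e δ'' = δ' ∧
      (E.obj (op B)).map d δ = (E.map g.op).app H δ''

namespace ExtriangulatedStructure

section

variable {C : Type u} [Category.{v} C] [Preadditive C] [HasZeroObject C] [HasBinaryBiproducts C]
  (S : ExtriangulatedStructure.{w} C)

/-- `X ⟶ Y ⟶ Z` is a conflation: it is part of an `𝔼`-triangle `X ⟶ Y ⟶ Z ⇢ δ`. -/
def IsConflation {X Y Z : C} (x : X ⟶ Y) (y : Y ⟶ Z) : Prop :=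
  ∃ δ : (S.E.obj (op Z)).obj X, S.Realizes x y δ

def IsInflation {X Y : C} (x : X ⟶ Y) : Prop :=
  ∃ (Z : C) (y : Y ⟶ Z), S.IsConflation x y

def IsDeflation {Y Z : C} (y : Y ⟶ Z) : Prop :=
  ∃ (X : C) (x : X ⟶ Y), S.IsConflation x y

/-- A morphism is compatible if it is an isomorphism as soon as it is both an inflation and a
deflation. -/
def IsCompatible {X Y : C} (f : X ⟶ Y) : Prop :=
  S.IsInflation f → S.IsDeflation f → IsIso f

/-- Right exact sequences `X ⟶ Y ⟶ Z`. -/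
def IsRightExactSeq {X Y Z : C} (f : X ⟶ Y) (g : Y ⟶ Z) : Prop :=
  ∃ (K : C) (h₁ : X ⟶ K) (h₂ : K ⟶ Y), S.IsConflation h₂ g ∧ S.IsDeflation h₁ ∧
    S.IsCompatible h₁ ∧ h₁ ≫ h₂ = f

/-- Left exact sequences `X ⟶ Y ⟶ Z`. -/
def IsLeftExactSeq {X Y Z : C} (f : X ⟶ Y) (g : Y ⟶ Z) : Prop :=
  ∃ (K : C) (h₁ : Y ⟶ K) (h₂ : K ⟶ Z), S.IsConflation f h₁ ∧ S.IsInflation h₂ ∧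
    S.IsCompatible h₂ ∧ h₁ ≫ h₂ = g

/-- Right exact four-term `𝔼`-triangle sequences `X ⟶ Y ⟶ Z ⟶ W`. -/
def IsRightExactTriangleSeq {X Y Z W : C} (f : X ⟶ Y) (g : Y ⟶ Z) (h : Z ⟶ W) : Prop :=
  ∃ (K : C) (g₁ : Y ⟶ K) (g₂ : K ⟶ Z), S.IsConflation f g₁ ∧ S.IsConflation g₂ h ∧
    g₁ ≫ g₂ = g ∧ S.IsCompatible g₁

/-- Left exact four-term `𝔼`-triangle sequences `X ⟶ Y ⟶ Z ⟶ W`. -/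
def IsLeftExactTriangleSeq {X Y Z W : C} (f : X ⟶ Y) (g : Y ⟶ Z) (h : Z ⟶ W) : Prop :=
  ∃ (K : C) (g₁ : Y ⟶ K) (g₂ : K ⟶ Z), S.IsConflation f g₁ ∧ S.IsConflation g₂ h ∧
    g₁ ≫ g₂ = g ∧ S.IsCompatible g₂

/-- The short exactness of `0 ⟶ L ⟶ M ⟶ N ⟶ 0` for abelian groups. -/
def IsShortExactAb {L M N : Type*} [AddCommGroup L] [AddCommGroup M] [AddCommGroup N]
    (f : L →+ M) (g : M →+ N) : Prop :=
  Function.Injective f ∧ Function.Exact f g ∧ Function.Surjective g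

/-- The sequence `X ⟶ Y ⟶ Z` is `C(-, W)`-exact: for every object `P` of the class `W`,
`0 ⟶ C(Z, P) ⟶ C(Y, P) ⟶ C(X, P) ⟶ 0` is exact. -/
def IsHomToExact (W : ObjectProperty C) {X Y Z : C} (x : X ⟶ Y) (y : Y ⟶ Z) : Prop :=
  ∀ P : C, W P → IsShortExactAb (Preadditive.leftComp P y) (Preadditive.leftComp P x)

/-- The sequence `X ⟶ Y ⟶ Z` is `C(W, -)`-exact: for every object `P` of the class `W`,
`0 ⟶ C(P, X) ⟶ C(P, Y) ⟶ C(P, Z) ⟶ 0` is exact. -/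
def IsHomFromExact (W : ObjectProperty C) {X Y Z : C} (x : X ⟶ Y) (y : Y ⟶ Z) : Prop :=
  ∀ P : C, W P → IsShortExactAb (Preadditive.rightComp P x) (Preadditive.rightComp P y)

/-- Projective objects: `0 ⟶ C(P, X) ⟶ C(P, Y) ⟶ C(P, Z) ⟶ 0` is exact for every `𝔼`-triangle
`X ⟶ Y ⟶ Z ⇢ δ`. -/
def IsProjective : ObjectProperty C := fun P =>
  ∀ ⦃X Y Z : C⦄ (x : X ⟶ Y) (y : Y ⟶ Z) (δ : (S.E.obj (op Z)).obj X), S.Realizes x y δ →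
    IsShortExactAb (Preadditive.rightComp P x) (Preadditive.rightComp P y)

/-- A decomposition of an unbounded complex `X` into `𝔼`-triangles
`K (n + 1) --g n--> X n --f n--> K n ⇢ δ n`, so that the differential `X (n + 1) ⟶ X n` is
`X (n + 1) --f (n + 1)--> K (n + 1) --g n--> X n`. -/
structure Decomposition (X : ChainComplex C ℤ) where
  K : ℤ → C
  g : ∀ n : ℤ, K (n + 1) ⟶ X.X n
  f : ∀ n : ℤ, X.X n ⟶ K n
  δ : ∀ n : ℤ, (S.E.obj (op (K n))).obj (K (n + 1))
  realizes : ∀ n : ℤ, S.Realizes (g n) (f n) (δ n)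
  d_eq : ∀ n : ℤ, X.d (n + 1) n = f (n + 1) ≫ g n

/-- Exact complexes. -/
def IsExactComplex (X : ChainComplex C ℤ) : Prop :=
  Nonempty (S.Decomposition X)

/-- `C(-, W)`-exact complexes. -/
def IsHomToExactComplex (W : ObjectProperty C) (X : ChainComplex C ℤ) : Prop :=
  ∃ D : S.Decomposition X, ∀ n : ℤ, IsHomToExact W (D.g n) (D.f n)

/-- `C(W, -)`-exact complexes. -/
def IsHomFromExactComplex (W : ObjectProperty C) (X : ChainComplex C ℤ) : Prop :=
  ∃ D : S.Decomposition X, ∀ n : ℤ, IsHomFromExact W (D.g n) (D.f n)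

/-- Complete `W`-exact complexes. -/
def IsCompleteExactComplex (W : ObjectProperty C) (X : ChainComplex C ℤ) : Prop :=
  S.IsExactComplex X ∧ S.IsHomToExactComplex W X ∧ S.IsHomFromExactComplex W X

/-- Complete projective resolutions. -/
def IsCompleteProjectiveResolution (X : ChainComplex C ℤ) : Prop :=
  S.IsCompleteExactComplex S.IsProjective X ∧ ∀ n : ℤ, S.IsProjective (X.X n)

/-- Gorenstein projective objects: the objects `K n` in a decomposition of a complete projective
resolution into `C(-, 𝒫(C))`-exact `𝔼`-triangles. -/
def IsGorensteinProjective : ObjectProperty C := fun G =>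
  ∃ X : ChainComplex C ℤ, S.IsCompleteProjectiveResolution X ∧
    ∃ D : S.Decomposition X, (∀ n : ℤ, IsHomToExact S.IsProjective (D.g n) (D.f n)) ∧
      ∃ n : ℤ, D.K n = G

end

section

variable {A : Type u₁} [Category.{v₁} A] [Preadditive A] [HasZeroObject A] [HasBinaryBiproducts A]
  {B : Type u₂} [Category.{v₂} B] [Preadditive B] [HasZeroObject B] [HasBinaryBiproducts B]
  (S : ExtriangulatedStructure.{w₁} A) (T : ExtriangulatedStructure.{w₂} B)

/-- Exact functors: additive functors sending `𝔼`-triangles to `𝔼`-triangles. -/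
structure IsExactFunctor (F : A ⥤ B) : Prop where
  additive : F.Additive
  map_triangle : ∀ ⦃X Y Z : A⦄ (x : X ⟶ Y) (y : Y ⟶ Z) (δ : (S.E.obj (op Z)).obj X),
    S.Realizes x y δ →
      ∃ δ' : (T.E.obj (op (F.obj Z))).obj (F.obj X), T.Realizes (F.map x) (F.map y) δ'

/-- Right exact functors: additive functors preserving compatible morphisms and right exact
sequences. -/
structure IsRightExactFunctor (F : A ⥤ B) : Prop where
  additive : F.Additive
  map_compatible : ∀ ⦃X Y : A⦄ (f : X ⟶ Y), S.IsCompatible f → T.IsCompatible (F.map f)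
  map_rightExactSeq : ∀ ⦃X Y Z : A⦄ (f : X ⟶ Y) (g : Y ⟶ Z),
    S.IsRightExactSeq f g → T.IsRightExactSeq (F.map f) (F.map g)

/-- Left exact functors: additive functors preserving compatible morphisms and left exact
sequences. -/
structure IsLeftExactFunctor (F : A ⥤ B) : Prop where
  additive : F.Additive
  map_compatible : ∀ ⦃X Y : A⦄ (f : X ⟶ Y), S.IsCompatible f → T.IsCompatible (F.map f)
  map_leftExactSeq : ∀ ⦃X Y Z : A⦄ (f : X ⟶ Y) (g : Y ⟶ Z),
    S.IsLeftExactSeq f g → T.IsLeftExactSeq (F.map f) (F.map g)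

end

end ExtriangulatedStructure

/-- A recollement `R(A', A, A'')` of extriangulated categories. -/
structure Recollement {A' : Type u₁} [Category.{v₁} A'] [Preadditive A'] [HasZeroObject A'] [HasBinaryBiproducts A']
    {A : Type u₂} [Category.{v₂} A] [Preadditive A] [HasZeroObject A] [HasBinaryBiproducts A]
    {A'' : Type u₃} [Category.{v₃} A''] [Preadditive A''] [HasZeroObject A''] [HasBinaryBiproducts A'']
    (S' : ExtriangulatedStructure.{w₁} A') (S : ExtriangulatedStructure.{w₂} A)
    (S'' : ExtriangulatedStructure.{w₃} A'') where
  /-- The functor `i^*`. -/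
  iUpperStar : A ⥤ A'
  /-- The functor `i_*`. -/
  iLowerStar : A' ⥤ A
  /-- The functor `i^!`. -/
  iUpperShriek : A ⥤ A'
  /-- The functor `j_!`. -/
  jLowerShriek : A'' ⥤ A
  /-- The functor `j^*`. -/
  jUpperStar : A ⥤ A''
  /-- The functor `j_*`. -/
  jLowerStar : A'' ⥤ A
  exact_iLowerStar : S'.IsExactFunctor S iLowerStar
  exact_jUpperStar : S.IsExactFunctor S'' jUpperStar
  rightExact_iUpperStar : S.IsRightExactFunctor S' iUpperStar
  rightExact_jLowerShriek : S''.IsRightExactFunctor S jLowerShriek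
  leftExact_iUpperShriek : S.IsLeftExactFunctor S' iUpperShriek
  leftExact_jLowerStar : S''.IsLeftExactFunctor S jLowerStar
  /-- (R1): the adjunction `i^* ⊣ i_*`. -/
  adjI : iUpperStar ⊣ iLowerStar
  /-- (R1): the adjunction `i_* ⊣ i^!`. -/
  adjI' : iLowerStar ⊣ iUpperShriek
  /-- (R1): the adjunction `j_! ⊣ j^*`. -/
  adjJ : jLowerShriek ⊣ jUpperStar
  /-- (R1): the adjunction `j^* ⊣ j_*`. -/
  adjJ' : jUpperStar ⊣ jLowerStar
  full_iLowerStar : iLowerStar.Full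
  faithful_iLowerStar : iLowerStar.Faithful
  full_jLowerShriek : jLowerShriek.Full
  faithful_jLowerShriek : jLowerShriek.Faithful
  full_jLowerStar : jLowerStar.Full
  faithful_jLowerStar : jLowerStar.Faithful
  /-- (R3): the essential image of `i_*` is the kernel of `j^*`. -/
  essImage_iff : ∀ X : A, iLowerStar.essImage X ↔ IsZero (jUpperStar.obj X)
  /-- (R4): a left exact `𝔼`-triangle sequence `i_* i^! X ⟶ X ⟶ j_* j^* X ⟶ i_* Y`. -/
  leftExact_triangle : ∀ X : A, ∃ (Y : A')
    (h : jLowerStar.obj (jUpperStar.obj X) ⟶ iLowerStar.obj Y),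
    S.IsLeftExactTriangleSeq (adjI'.counit.app X) (adjJ'.unit.app X) h
  /-- (R5): a right exact `𝔼`-triangle sequence `i_* Y ⟶ j_! j^* X ⟶ X ⟶ i_* i^* X`. -/
  rightExact_triangle : ∀ X : A, ∃ (Y : A')
    (h : iLowerStar.obj Y ⟶ jLowerShriek.obj (jUpperStar.obj X)),
    S.IsRightExactTriangleSeq h (adjJ.counit.app X) (adjI.unit.app X)

/-! Both parts are cases of `IsGorensteinProjective.map_leftAdjoint`: if `F ⊣ G` with both functors
exact and `G` preserving projectives, then `F` preserves Gorenstein projectives. Exactness of `F`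
carries a decomposition into triangles to another one, `F` preserves projectives because `G` is
exact, and `Hom(F -, P) ≅ Hom(-, G P)` turns exactness against the projective `P` into exactness
against the projective `G P`. What remains is that `G` preserves projectives, which holds once `G`
is in turn left adjoint to an exact functor. For `F = j_!`, `G = j^*`, that functor is `j_*`. For `F
= i_*`, `G = i^!`, faithfulness of `i^*` and `i^* j_! = 0` force `j^* = 0`, so `i_*` is an
equivalence and its quasi-inverse `i^!` is also left adjoint to `i_*`. -/

namespace ExtriangulatedStructure

section

variable {L M N L' M' N' : Type*} [AddCommGroup L] [AddCommGroup M] [AddCommGroup N]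
  [AddCommGroup L'] [AddCommGroup M'] [AddCommGroup N']

/-- Short exactness is invariant under isomorphisms of sequences of abelian groups. -/
lemma IsShortExactAb.of_addEquiv {f : L →+ M} {g : M →+ N} {f' : L' →+ M'} {g' : M' →+ N'}
    (h : IsShortExactAb f' g') (e₁ : L ≃+ L') (e₂ : M ≃+ M') (e₃ : N ≃+ N')
    (hf : ∀ a, e₂ (f a) = f' (e₁ a)) (hg : ∀ b, e₃ (g b) = g' (e₂ b)) :
    IsShortExactAb f g := by
  obtain ⟨hinj, hex, hsurj⟩ := h
  refine ⟨fun a b hab => e₁.injective (hinj ?_), fun b => ?_, fun c => ?_⟩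
  · rw [← hf, ← hf, hab]
  · rw [← e₃.map_eq_zero_iff, hg, hex]
    constructor
    · rintro ⟨a', ha'⟩
      exact ⟨e₁.symm a', e₂.injective (by rw [hf, e₁.apply_symm_apply, ha'])⟩
    · rintro ⟨a, rfl⟩
      exact ⟨e₁ a, (hf a).symm⟩
  · obtain ⟨b', hb'⟩ := hsurj (e₃ c)
    exact ⟨e₂.symm b', e₃.injective (by rw [hg, e₂.apply_symm_apply, hb'])⟩

end

section

variable {A : Type u₁} [Category.{v₁} A] [Preadditive A] {B : Type u₂} [Category.{v₂} B]
  [Preadditive B] {F : A ⥤ B} {G : B ⥤ A}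

/-- If the right adjoint `G` of `F` sends `W` to `V`, then `F` sends `C(-, V)`-exact sequences to
`C(-, W)`-exact sequences. -/
lemma IsHomToExact.map_leftAdjoint (adj : F ⊣ G) [F.Additive] {V : ObjectProperty A}
    {W : ObjectProperty B} (hVW : ∀ P, W P → V (G.obj P)) {X Y Z : A} {x : X ⟶ Y} {y : Y ⟶ Z}
    (h : IsHomToExact V x y) : IsHomToExact W (F.map x) (F.map y) := fun P hP =>
  -- `Hom(-, P)` is contravariant, hence the order `Z`, `Y`, `X`.
  (h _ (hVW P hP)).of_addEquiv (adj.homAddEquiv Z P) (adj.homAddEquiv Y P) (adj.homAddEquiv X P)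
    (fun f => adj.homEquiv_naturality_left y f) (fun f => adj.homEquiv_naturality_left x f)

end

section

variable {A : Type u₁} [Category.{v₁} A] [Preadditive A] [HasZeroObject A] [HasBinaryBiproducts A]
  {B : Type u₂} [Category.{v₂} B] [Preadditive B] [HasZeroObject B] [HasBinaryBiproducts B]
  {S : ExtriangulatedStructure.{w₁} A} {T : ExtriangulatedStructure.{w₂} B}
  {F : A ⥤ B} {G : B ⥤ A}

/-- A left adjoint of an exact functor preserves projective objects. -/
lemma IsProjective.map_leftAdjoint (adj : F ⊣ G) (hG : T.IsExactFunctor S G) {P : A}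
    (hP : S.IsProjective P) : T.IsProjective (F.obj P) := by
  intro X Y Z x y δ h
  obtain ⟨δ', h'⟩ := hG.map_triangle x y δ h
  have := hG.additive
  have := adj.left_adjoint_additive
  exact (hP _ _ δ' h').of_addEquiv (adj.homAddEquiv P X) (adj.homAddEquiv P Y)
    (adj.homAddEquiv P Z) (fun f => adj.homEquiv_naturality_right f x)
    (fun f => adj.homEquiv_naturality_right f y)

/-- The image of a decomposition of a complex under an exact functor. -/
noncomputable def Decomposition.map (F : A ⥤ B) [F.Additive] (hF : S.IsExactFunctor T F)
    {X : ChainComplex A ℤ} (D : S.Decomposition X) :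
    T.Decomposition ((F.mapHomologicalComplex _).obj X) where
  K n := F.obj (D.K n)
  g n := F.map (D.g n)
  f n := F.map (D.f n)
  -- Exactness of `F` only asserts that some extension is realized by the image sequence, so one is
  -- chosen.
  δ n := (hF.map_triangle _ _ _ (D.realizes n)).choose
  realizes n := (hF.map_triangle _ _ _ (D.realizes n)).choose_spec
  d_eq n := (congrArg F.map (D.d_eq n)).trans (F.map_comp _ _)

/-- Every decomposition consists of `C(𝒫(C), -)`-exact `𝔼`-triangles. -/
lemma Decomposition.isHomFromExact_isProjective {X : ChainComplex A ℤ} (D : S.Decomposition X)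
    (n : ℤ) : IsHomFromExact S.IsProjective (D.g n) (D.f n) :=
  fun _ hP => hP _ _ _ (D.realizes n)

/-- An exact functor whose right adjoint is exact and preserves projective objects preserves
Gorenstein projective objects. -/
lemma IsGorensteinProjective.map_leftAdjoint (adj : F ⊣ G) (hF : S.IsExactFunctor T F)
    (hG : T.IsExactFunctor S G) (hproj : ∀ P, T.IsProjective P → S.IsProjective (G.obj P))
    {X : A} (hX : S.IsGorensteinProjective X) : T.IsGorensteinProjective (F.obj X) := by
  obtain ⟨Q, ⟨-, hQ⟩, D, hD, n, rfl⟩ := hX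
  have := hF.additive
  have hTo : ∀ n, IsHomToExact T.IsProjective ((D.map F hF).g n) ((D.map F hF).f n) :=
    fun n => (hD n).map_leftAdjoint adj hproj
  exact ⟨(F.mapHomologicalComplex _).obj Q,
    -- The image of the single decomposition `D` witnesses all three exactness conditions; the
    -- `C(𝒫(C), -)` one is automatic from the definition of projectives.
    ⟨⟨⟨D.map F hF⟩, ⟨D.map F hF, hTo⟩, ⟨D.map F hF, (D.map F hF).isHomFromExact_isProjective⟩⟩,
      fun n => (hQ n).map_leftAdjoint adj hG⟩, D.map F hF, hTo, n, rfl⟩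

end

end ExtriangulatedStructure

namespace Recollement

variable {A' : Type u₁} [Category.{v₁} A'] [Preadditive A'] [HasZeroObject A']
  [HasBinaryBiproducts A']
  {A : Type u₂} [Category.{v₂} A] [Preadditive A] [HasZeroObject A] [HasBinaryBiproducts A]
  {A'' : Type u₃} [Category.{v₃} A''] [Preadditive A''] [HasZeroObject A'']
  [HasBinaryBiproducts A'']
  {S' : ExtriangulatedStructure.{w₁} A'} {S : ExtriangulatedStructure.{w₂} A}
  {S'' : ExtriangulatedStructure.{w₃} A''} (R : Recollement S' S S'')

lemma isZero_jUpperStar_iLowerStar (X : A') :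
    IsZero (R.jUpperStar.obj (R.iLowerStar.obj X)) :=
  (R.essImage_iff _).1 (R.iLowerStar.obj_mem_essImage X)

/-- The composition `i^* j_!` vanishes. -/
lemma isZero_iUpperStar_jLowerShriek (Y : A'') :
    IsZero (R.iUpperStar.obj (R.jLowerShriek.obj Y)) := by
  rw [IsZero.iff_id_eq_zero]
  -- Transposing twice moves endomorphisms of `i^* j_! Y` to morphisms `Y ⟶ j^* i_* i^* j_! Y`,
  -- whose target is zero.
  apply (R.adjI.homEquiv _ _).injective
  apply (R.adjJ.homEquiv _ _).injective
  exact (R.isZero_jUpperStar_iLowerStar _).eq_of_tgt _ _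

/-- If `i^*` is faithful, then `i_*` is an equivalence of categories. -/
lemma isEquivalence_iLowerStar (h : R.iUpperStar.Faithful) : R.iLowerStar.IsEquivalence := by
  have := R.full_iLowerStar
  have := R.faithful_iLowerStar
  refine { essSurj := ⟨fun X => (R.essImage_iff X).2 ?_⟩ }
  -- The faithful functor `i^*` kills `j_! j^* X`, so this object is zero; faithfulness of `j_!`
  -- then gives `j^* X = 0`.
  have hX : 𝟙 (R.jLowerShriek.obj (R.jUpperStar.obj X)) = 0 :=
    R.iUpperStar.map_injective ((R.isZero_iUpperStar_jLowerShriek _).eq_of_src _ _)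
  have := R.faithful_jLowerShriek
  have := R.rightExact_jLowerShriek.additive
  rw [IsZero.iff_id_eq_zero]
  apply R.jLowerShriek.map_injective
  rw [R.jLowerShriek.map_id, hX, R.jLowerShriek.map_zero]

/-- If `i^*` is faithful, then `i^!` is left adjoint to `i_*`. -/
noncomputable def adjOfFaithful (h : R.iUpperStar.Faithful) : R.iUpperShriek ⊣ R.iLowerStar :=
  have := R.isEquivalence_iLowerStar h
  -- The quasi-inverse of `i_*` is adjoint to it on both sides; uniqueness of right adjoints
  -- identifies it with `i^!`.
  R.iLowerStar.asEquivalence.symm.toAdjunction.ofNatIsoLeft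
    (R.iLowerStar.asEquivalence.toAdjunction.rightAdjointUniq R.adjI')

end Recollement

theorem proposition4p6
    {A' : Type u₁} [Category.{v₁} A'] [Preadditive A'] [HasZeroObject A'] [HasBinaryBiproducts A']
    {A : Type u₂} [Category.{v₂} A] [Preadditive A] [HasZeroObject A] [HasBinaryBiproducts A]
    {A'' : Type u₃} [Category.{v₃} A''] [Preadditive A''] [HasZeroObject A''] [HasBinaryBiproducts A'']
    (S' : ExtriangulatedStructure.{w₁} A') (S : ExtriangulatedStructure.{w₂} A)
    (S'' : ExtriangulatedStructure.{w₃} A'') (R : Recollement S' S S'') :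
    (∀ X' : A', S'.IsGorensteinProjective X' →
      S.IsExactFunctor S' R.iUpperShriek → S.IsExactFunctor S' R.iUpperStar →
      R.iUpperStar.Faithful → S.IsGorensteinProjective (R.iLowerStar.obj X')) ∧
    (∀ X'' : A'', S''.IsGorensteinProjective X'' →
      S''.IsExactFunctor S R.jLowerShriek → S''.IsExactFunctor S R.jLowerStar →
      S.IsGorensteinProjective (R.jLowerShriek.obj X'')) :=
  ⟨fun _ hX hShriek _ hfaithful => hX.map_leftAdjoint R.adjI' R.exact_iLowerStar hShriek
      fun _ hP => hP.map_leftAdjoint (R.adjOfFaithful hfaithful) R.exact_iLowerStar,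
    fun _ hX hjShriek hjStar => hX.map_leftAdjoint R.adjJ hjShriek R.exact_jUpperStar
      fun _ hP => hP.map_leftAdjoint R.adjJ' hjStar⟩
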